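/- Let $\mathcal V\neq\{0\}$ be a finite-dimensional real or complex vector space with a scalar product, let $\|\cdot\|_\infty$ be the induced operator norm on the linear endomorphisms of $\mathcal V$, and let $\mathcal T$ be an endomorphism of $\mathcal V$ whose semigroup $(\mathcal T^n)_{n\ge0}$ is bounded, i.e. $\sup_{n\ge 0}\|\mathcal T^n\|<\infty$ for some norm $\|\cdot\|$ on the space of endomorphisms. Define $\mathcal T_\infty=\sum_{|\lambda_i|=1}\lambda_i\mathcal P_i$, the sum running over the distinct eigenvalues $\lambda_i$ of $\mathcal T$ of modulus $1$, where $\mathcal P_i$ is the spectral projector of $\lambda_i$ (the projector onto the generalized eigenspace of $\lambda_i$ along the sum of the other generalized eigenspaces). Let $\mu$ be the spectral radius of $\mathcal T-\mathcal T_\infty$, and let $d_\mu$ be the size of the largest Jordan block of $\mathcal T-\mathcal T_\infty$ that belongs to an eigenvalue of modulus $\mu$. (If $\mathcal V$ is real, eigenvalues, spectral projectors and Jordan blocks are those of the complexification; $\mathcal T_\infty$ is then again a real map.) Then there are constants $C_1,C_2>0$, which may depend on $\mathcal T$ but not on $n$, such that for all integers $n\ge1$ (with $n\ge d_\mu-1$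 if $\mu=0$, and with the convention $0^0=1$) $$C_1\,\mu^{n-d_\mu+1}\,n^{d_\mu-1}\;\le\;\|\mathcal T^n-\mathcal T_\infty^n\|_\infty\;\le\;C_2\,\mu^{n-d_\mu+1}\,n^{d_\mu-1}.$$ -/

import Mathlib

open scoped TensorProduct

namespace BoundedSemigroup

noncomputable section

section Complex

variable {W : Type*} [AddCommGroup W] [Module ℂ W] [FiniteDimensional ℂ W]

/-- On a finite-dimensional complex space, the generalized eigenspace of `z` is complementary to
the sum of all the other generalized eigenspaces. -/
theorem isCompl_maxGenEigenspace (T : Module.End ℂ W) (z : ℂ) :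
    IsCompl (T.maxGenEigenspace z) (⨆ (w : ℂ) (_ : w ≠ z), T.maxGenEigenspace w) := by
  refine ⟨T.independent_maxGenEigenspace z, codisjoint_iff.2 (eq_top_iff.2 ?_)⟩
  rw [← Module.End.iSup_maxGenEigenspace_eq_top T]
  refine iSup_le fun w => ?_
  by_cases h : w = z
  · subst h
    exact le_sup_left
  · exact le_sup_of_le_right (le_iSup₂_of_le w h le_rfl)

/-- The spectral projector of `T` at `z`: the projector onto the generalized eigenspace of `z`
along the sum of the other generalized eigenspaces. -/
def spectralProjector (T : Module.End ℂ W) (z : ℂ) : Module.End ℂ W :=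
  (T.maxGenEigenspace z).projection _ (isCompl_maxGenEigenspace T z)

/-- The asymptotic part `∑ z • P_z` of a complex linear map, summed over the distinct eigenvalues
`z` of modulus one. -/
def asymptoticPart (T : Module.End ℂ W) : Module.End ℂ W :=
  ∑ z ∈ T.finite_hasEigenvalue.toFinset with ‖z‖ = 1, z • spectralProjector T z

/-- The largest modulus of an eigenvalue, as a real number. -/
def specRad (M : Module.End ℂ W) : ℝ :=
  (spectralRadius ℂ M).toReal

/-- A Jordan normal form of `M`: a basis `b i 0, …, b i (size i - 1)` (`i` running over the
blocks) with `M (b i 0) = λ i • b i 0` and `M (b i (j+1)) = λ i • b i (j+1) + b i j`. -/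
structure JordanForm (M : Module.End ℂ W) where
  /-- the number of Jordan blocks -/
  numBlocks : ℕ
  /-- the sizes of the blocks -/
  size : Fin numBlocks → ℕ
  size_pos : ∀ i, 0 < size i
  /-- the eigenvalues of the blocks -/
  eigenvalue : Fin numBlocks → ℂ
  /-- the Jordan basis -/
  basis : Module.Basis (Σ i, Fin (size i)) ℂ W
  apply_zero : ∀ (i : Fin numBlocks) (h : 0 < size i),
    M (basis ⟨i, ⟨0, h⟩⟩) = eigenvalue i • basis ⟨i, ⟨0, h⟩⟩
  apply_succ : ∀ (i : Fin numBlocks) (j : ℕ) (h : j + 1 < size i),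
    M (basis ⟨i, ⟨j + 1, h⟩⟩) =
      eigenvalue i • basis ⟨i, ⟨j + 1, h⟩⟩ + basis ⟨i, ⟨j, Nat.lt_of_succ_lt h⟩⟩

/-- The size of the largest Jordan block of `M` that belongs to an eigenvalue of modulus `r`. -/
def maxJordanBlock (M : Module.End ℂ W) (r : ℝ) : ℕ :=
  sSup {k | ∃ (J : JordanForm M) (i : Fin J.numBlocks), ‖J.eigenvalue i‖ = r ∧ J.size i = k}

end Complex

section Real

variable {V : Type*} [AddCommGroup V] [Module ℝ V] [FiniteDimensional ℝ V]

/-- The complexification of a linear map on a real space. -/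
abbrev complexify (T : Module.End ℝ V) : Module.End ℂ (ℂ ⊗[ℝ] V) :=
  T.baseChange ℂ

/-- The real-linear map `z ⊗ v ↦ (re z) • v`. -/
def tensorRe : ℂ ⊗[ℝ] V →ₗ[ℝ] V :=
  (TensorProduct.lid ℝ V).toLinearMap ∘ₗ Complex.reLm.rTensor V

/-- The asymptotic part of a linear map on a real space: the restriction to `V` of the asymptotic
part of its complexification (which commutes with complex conjugation, since the non-real
eigenvalues come in conjugate pairs, and therefore maps `V` to `V`). -/
def asymptoticPartReal (T : Module.End ℝ V) : Module.End ℝ V :=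
  tensorRe ∘ₗ (asymptoticPart (complexify T)).restrictScalars ℝ ∘ₗ TensorProduct.mk ℝ ℂ V 1

end Real

/-- The operator norm of a linear map on a finite-dimensional Hilbert space. -/
def opNorm {𝕜 V : Type*} [RCLike 𝕜] [NormedAddCommGroup V] [InnerProductSpace 𝕜 V]
    [FiniteDimensional 𝕜 V] (A : Module.End 𝕜 V) : ℝ :=
  ‖LinearMap.toContinuousLinearMap A‖

end

end BoundedSemigroup

/-! A Jordan chain of length two at an eigenvalue of modulus one would make some matrix coefficient
of `T ^ n` grow linearly, so boundedness forces `T` to act as a scalar on each such generalized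
eigenspace. Hence `T` agrees with its asymptotic part there, while on the other generalized
eigenspaces the asymptotic part vanishes. The asymptotic part and the remainder `M` therefore
annihilate each other, and the difference of the `n`-th powers is `M ^ n` for `n ≥ 1`
(`IsWeaklyPowerBounded.pow_sub_pow`).

What remains is the growth of `M ^ n`. In a Jordan basis its nonzero entries are `n.choose j * z ^
(n - j)`. Blocks of maximal modulus and maximal size dominate all others and give both bounds;
equivalence of norms in finite dimension transfers them to the operator norm
(`exists_growth_bounds`). The real case embeds into the complex one by the injective map
`complexify`, once the asymptotic part is known to commute with conjugation. -/

namespace BoundedSemigroup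

/-! ### Splitting off the eigenvalues of modulus one -/

section Complex

variable {W : Type*} [AddCommGroup W] [Module ℂ W] [FiniteDimensional ℂ W]

theorem spectralProjector_apply_self (T : Module.End ℂ W) {z : ℂ} {x : W}
    (hx : x ∈ T.maxGenEigenspace z) : spectralProjector T z x = x :=
  Submodule.projection_apply_of_mem_left _ hx

theorem spectralProjector_apply_of_ne (T : Module.End ℂ W) {z w : ℂ} (h : w ≠ z) {x : W}
    (hx : x ∈ T.maxGenEigenspace w) : spectralProjector T z x = 0 :=
  (Submodule.projection_apply_eq_zero_iff _).2
    ((le_iSup₂_of_le w h le_rfl : T.maxGenEigenspace w ≤ _) hx)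

theorem asymptoticPart_apply (T : Module.End ℂ W) {w : ℂ} {x : W}
    (hx : x ∈ T.maxGenEigenspace w) :
    asymptoticPart T x = if ‖w‖ = 1 then w • x else 0 := by
  rcases eq_or_ne x 0 with rfl | h0
  · simp
  have hw : T.HasEigenvalue w := by
    by_contra h
    have h' : ¬ T.HasUnifEigenvalue w ⊤ := fun h' => h (h'.lt zero_lt_one)
    rw [Module.End.HasUnifEigenvalue, not_not] at h'
    exact h0 ((Submodule.mem_bot ℂ).1 (h' ▸ hx))
  have key : ∀ z, (z • spectralProjector T z) x = if w = z then w • x else 0 := by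
    intro z
    split_ifs with h
    · subst h
      simp [spectralProjector_apply_self T hx]
    · simp [spectralProjector_apply_of_ne T h hx]
  simp only [asymptoticPart, LinearMap.sum_apply, key, Finset.sum_ite_eq, Finset.mem_filter,
    Set.Finite.mem_toFinset, Set.mem_ofPred_eq, hw, true_and]

/-- The generalized eigenspaces span `W`. Only additivity is required, so that conjugate-linear maps
can be compared too. -/
theorem end_ext_maxGenEigenspace (T : Module.End ℂ W) {E F : Type*} [AddCommGroup E]
    [FunLike F W E] [AddMonoidHomClass F W E] (A B : F)
    (h : ∀ w, ∀ x ∈ T.maxGenEigenspace w, A x = B x) : A = B := by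
  refine DFunLike.ext _ _ fun x => ?_
  have hx : x ∈ ⨆ w, T.maxGenEigenspace w := by
    rw [Module.End.iSup_maxGenEigenspace_eq_top T]; trivial
  induction hx using Submodule.iSup_induction' with
  | mem w x hx => exact h w x hx
  | zero => simp
  | add x y _ _ hx hy => rw [map_add, map_add, hx, hy]

omit [FiniteDimensional ℂ W] in
theorem apply_mem_maxGenEigenspace (T : Module.End ℂ W) {w : ℂ} {x : W}
    (hx : x ∈ T.maxGenEigenspace w) : T x ∈ T.maxGenEigenspace w :=
  T.mapsTo_maxGenEigenspace_of_comm rfl w hx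

/-- Every matrix coefficient of the semigroup generated by `T` is bounded. -/
def IsWeaklyPowerBounded (T : Module.End ℂ W) : Prop :=
  ∀ l : Module.End ℂ W →ₗ[ℂ] ℂ, ∃ C : ℝ, ∀ n : ℕ, ‖l (T ^ n)‖ ≤ C

theorem pow_apply_of_sub_smul_eq {R U : Type*} [CommRing R] [AddCommGroup U] [Module R U]
    (T : Module.End R U) {z : R} {v u : U}
    (hv : T v = z • v + u) (hu : T u = z • u) (n : ℕ) :
    (T ^ (n + 1)) v = z ^ (n + 1) • v + ((n + 1) * z ^ n) • u := by
  induction n with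
  | zero => simp [hv]
  | succ n ih =>
    rw [pow_succ', Module.End.mul_apply, ih, map_add, map_smul, map_smul, hv, hu]
    push_cast
    module

/-- If `u = (T - z) v` were nonzero, a functional `f` with `f u ≠ 0` would see the term `(n + 1) * z
^ n * f u` in `f (T ^ (n + 1) v)`, which is unbounded since `‖z‖ = 1`. -/
theorem IsWeaklyPowerBounded.sub_apply_eq_zero {T : Module.End ℂ W} (hT : IsWeaklyPowerBounded T)
    {z : ℂ} (hz : ‖z‖ = 1) {v : W} (hv : (T - algebraMap ℂ _ z) ((T - algebraMap ℂ _ z) v) = 0) :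
    (T - algebraMap ℂ _ z) v = 0 := by
  set u := (T - algebraMap ℂ _ z) v with hu
  rw [← Module.forall_dual_apply_eq_zero_iff ℂ]
  intro f
  by_contra hf
  have h1 : T v = z • v + u := by simp [hu]
  have h2 : T u = z • u := by simpa [sub_eq_zero] using hv
  obtain ⟨C, hC⟩ := hT (f ∘ₗ LinearMap.applyₗ v)
  obtain ⟨n, hn⟩ := exists_nat_gt ((C + ‖f v‖) / ‖f u‖)
  rw [div_lt_iff₀ (norm_pos_iff.2 hf)] at hn
  have h3 := hC (n + 1)
  simp only [LinearMap.comp_apply, LinearMap.applyₗ_apply_apply,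
    pow_apply_of_sub_smul_eq T h1 h2 n, map_add, map_smul, smul_eq_mul] at h3
  have h4 := norm_sub_le (z ^ (n + 1) * f v + (n + 1) * z ^ n * f u) (z ^ (n + 1) * f v)
  have h5 : ‖(n : ℂ) + 1‖ = n + 1 := by
    exact_mod_cast Complex.norm_natCast (n + 1)
  rw [add_sub_cancel_left, norm_mul, norm_mul, norm_mul, norm_pow, norm_pow, hz, h5] at h4
  simp only [one_pow, mul_one, one_mul] at h4
  nlinarith [norm_nonneg (f u)]

theorem IsWeaklyPowerBounded.apply_eq_smul {T : Module.End ℂ W} (hT : IsWeaklyPowerBounded T)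
    {z : ℂ} (hz : ‖z‖ = 1) {x : W} (hx : x ∈ T.maxGenEigenspace z) : T x = z • x := by
  obtain ⟨k, hk⟩ := (Module.End.mem_maxGenEigenspace T z x).1 hx
  rw [← Algebra.algebraMap_eq_smul_one] at hk
  suffices h : (T - algebraMap ℂ _ z) x = 0 by simpa [sub_eq_zero] using h
  clear hx
  induction k generalizing x with
  | zero => simp_all
  | succ k ih =>
    rw [pow_succ, Module.End.mul_apply] at hk
    exact hT.sub_apply_eq_zero hz (ih hk)

/-- On each generalized eigenspace one of the two factors is zero: the second if the modulus is one,
the first otherwise. -/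
theorem IsWeaklyPowerBounded.asymptoticPart_mul_sub {T : Module.End ℂ W}
    (hT : IsWeaklyPowerBounded T) : asymptoticPart T * (T - asymptoticPart T) = 0 := by
  refine end_ext_maxGenEigenspace T _ _ fun w x hx => ?_
  simp only [Module.End.mul_apply, LinearMap.sub_apply, map_sub, LinearMap.zero_apply,
    asymptoticPart_apply T hx, asymptoticPart_apply T (apply_mem_maxGenEigenspace T hx)]
  split_ifs with h
  · simp [hT.apply_eq_smul h hx, asymptoticPart_apply T hx, h]
  · simp

theorem IsWeaklyPowerBounded.sub_mul_asymptoticPart {T : Module.End ℂ W}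
    (hT : IsWeaklyPowerBounded T) : (T - asymptoticPart T) * asymptoticPart T = 0 := by
  refine end_ext_maxGenEigenspace T _ _ fun w x hx => ?_
  simp only [Module.End.mul_apply, LinearMap.sub_apply, LinearMap.zero_apply,
    asymptoticPart_apply T hx]
  split_ifs with h
  · simp [hT.apply_eq_smul h hx, asymptoticPart_apply T hx, h]
  · simp

/-- All mixed products vanish. The exponent must be positive: at exponent zero the sides are `1` and
`1 + 1`. -/
theorem add_pow_of_mul_eq_zero {R : Type*} [Ring R] {a b : R} (hab : a * b = 0) (hba : b * a = 0)
    (n : ℕ) : (a + b) ^ (n + 1) = a ^ (n + 1) + b ^ (n + 1) := by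
  induction n with
  | zero => simp
  | succ n ih =>
    rw [pow_succ, ih, add_mul, mul_add, mul_add, ← pow_succ, ← pow_succ, pow_succ a n,
      pow_succ b n, mul_assoc _ a b, mul_assoc _ b a, hab, hba]
    simp

theorem IsWeaklyPowerBounded.pow_sub_pow {T : Module.End ℂ W} (hT : IsWeaklyPowerBounded T)
    {n : ℕ} (hn : 1 ≤ n) : T ^ n - asymptoticPart T ^ n = (T - asymptoticPart T) ^ n := by
  obtain ⟨n, rfl⟩ := Nat.exists_eq_add_of_le' hn
  rw [sub_eq_iff_eq_add, ← add_pow_of_mul_eq_zero hT.sub_mul_asymptoticPart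
    hT.asymptoticPart_mul_sub, sub_add_cancel]

end Complex

/-! ### Complexification and descent of the asymptotic part to the real space -/

section Real

variable {V : Type*} [AddCommGroup V] [Module ℝ V]

/-- Complex conjugation on the complexification of a real space. -/
noncomputable def tensorConj : ℂ ⊗[ℝ] V →ₗ[ℝ] ℂ ⊗[ℝ] V :=
  Complex.conjAe.toLinearMap.rTensor V

theorem tensorConj_tmul (z : ℂ) (v : V) :
    tensorConj (z ⊗ₜ[ℝ] v) = (starRingEnd ℂ z) ⊗ₜ v := by
  simp [tensorConj]

theorem tensorConj_smul (z : ℂ) (x : ℂ ⊗[ℝ] V) :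
    tensorConj (z • x) = starRingEnd ℂ z • tensorConj x := by
  induction x using TensorProduct.induction_on with
  | zero => simp
  | tmul w v => simp [tensorConj_tmul, TensorProduct.smul_tmul']
  | add x y hx hy => rw [smul_add, map_add, hx, hy, map_add, smul_add]

theorem complexify_tensorConj (T : Module.End ℝ V) (x : ℂ ⊗[ℝ] V) :
    complexify T (tensorConj x) = tensorConj (complexify T x) := by
  induction x using TensorProduct.induction_on with
  | zero => simp
  | tmul w v => simp [tensorConj_tmul]
  | add x y hx hy => simp only [map_add, hx, hy]

theorem complexify_sub (A B : Module.End ℝ V) :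
    complexify (A - B) = complexify A - complexify B :=
  LinearMap.baseChange_sub A B

theorem complexify_pow (A : Module.End ℝ V) (n : ℕ) : complexify (A ^ n) = complexify A ^ n :=
  LinearMap.baseChange_pow ..

theorem tensorRe_tmul (z : ℂ) (v : V) : tensorRe (z ⊗ₜ[ℝ] v) = z.re • v := by
  simp [tensorRe]

theorem tensorRe_one_tmul (v : V) : tensorRe ((1 : ℂ) ⊗ₜ[ℝ] v) = v := by
  simp [tensorRe_tmul]

theorem one_tmul_tensorRe (x : ℂ ⊗[ℝ] V) :
    (2 : ℝ) • ((1 : ℂ) ⊗ₜ[ℝ] tensorRe x) = x + tensorConj x := by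
  induction x using TensorProduct.induction_on with
  | zero => simp
  | tmul w v =>
    rw [tensorConj_tmul, tensorRe_tmul, ← TensorProduct.add_tmul, Complex.add_conj,
      TensorProduct.tmul_smul, smul_smul, TensorProduct.smul_tmul']
    simp
  | add x y hx hy =>
    rw [map_add, TensorProduct.tmul_add, smul_add, hx, hy, map_add]; abel

theorem nontrivial_complexification [Nontrivial V] : Nontrivial (ℂ ⊗[ℝ] V) :=
  Function.Injective.nontrivial (f := fun v : V => (1 : ℂ) ⊗ₜ[ℝ] v) fun v w h => by
    simpa [tensorRe_one_tmul] using congrArg tensorRe h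

theorem tensorConj_mem_maxGenEigenspace (T : Module.End ℝ V) {w : ℂ} {x : ℂ ⊗[ℝ] V}
    (hx : x ∈ (complexify T).maxGenEigenspace w) :
    tensorConj x ∈ (complexify T).maxGenEigenspace (starRingEnd ℂ w) := by
  rw [Module.End.mem_maxGenEigenspace] at hx ⊢
  obtain ⟨k, hk⟩ := hx
  refine ⟨k, ?_⟩
  have key : ∀ (k : ℕ) (y : ℂ ⊗[ℝ] V),
      ((complexify T - starRingEnd ℂ w • (1 : Module.End ℂ (ℂ ⊗[ℝ] V))) ^ k) (tensorConj y) =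
      tensorConj (((complexify T - w • (1 : Module.End ℂ (ℂ ⊗[ℝ] V))) ^ k) y) := by
    intro k
    induction k with
    | zero => simp
    | succ k ih =>
      intro y
      rw [pow_succ, pow_succ, Module.End.mul_apply, Module.End.mul_apply, ← ih]
      congr 1
      simp only [LinearMap.sub_apply, complexify_tensorConj, LinearMap.smul_apply,
        Module.End.one_apply, map_sub, tensorConj_smul]
  rw [key, hk, map_zero]

variable [FiniteDimensional ℝ V]

/-- Conjugation carries the generalized eigenspace of `w` to that of the conjugate of `w`, which has
the same modulus. -/
theorem asymptoticPart_tensorConj (T : Module.End ℝ V) (x : ℂ ⊗[ℝ] V) :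
    asymptoticPart (complexify T) (tensorConj x) =
      tensorConj (asymptoticPart (complexify T) x) := by
  refine DFunLike.congr_fun (end_ext_maxGenEigenspace (complexify T)
    ((asymptoticPart (complexify T)).restrictScalars ℝ ∘ₗ tensorConj)
    (tensorConj ∘ₗ (asymptoticPart (complexify T)).restrictScalars ℝ) fun w x hx => ?_) x
  simp only [LinearMap.comp_apply, LinearMap.restrictScalars_apply, asymptoticPart_apply _ hx,
    asymptoticPart_apply _ (tensorConj_mem_maxGenEigenspace T hx), RCLike.norm_conj]
  split_ifs <;> simp [tensorConj_smul]

/-- The vector `1 ⊗ₜ v` is fixed by conjugation, hence so is its image; a fixed vector equals `1 ⊗ₜ`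
its real part. -/
theorem complexify_asymptoticPartReal (T : Module.End ℝ V) :
    complexify (asymptoticPartReal T) = asymptoticPart (complexify T) := by
  ext v
  have h := one_tmul_tensorRe (asymptoticPart (complexify T) (1 ⊗ₜ v))
  rw [← asymptoticPart_tensorConj, tensorConj_tmul, map_one, ← two_smul ℝ] at h
  simpa [asymptoticPartReal] using smul_right_injective _ (two_ne_zero (α := ℝ)) h

end Real

/-! ### Existence of the Jordan normal form -/

section JordanForm

open Polynomial

/-- The classes of `(X - a) ^ j`, `j < k`, form a basis of `K[X] ⧸ (X - a) ^ k`. -/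
theorem exists_basis_quotient_X_sub_C_pow {K : Type*} [Field K] (a : K) (k : ℕ) :
    ∃ b : Module.Basis (Fin k) K (K[X] ⧸ Submodule.span K[X] {(X - C a) ^ k}),
      ∀ j, b j = Submodule.Quotient.mk ((X - C a) ^ (k - 1 - (j : ℕ))) := by
  classical
  let v : Fin k → K[X] ⧸ Submodule.span K[X] {(X - C a) ^ k} :=
    fun j => Submodule.Quotient.mk ((X - C a) ^ (j : ℕ))
  have hspan : ⊤ ≤ Submodule.span K (Set.range v) := by
    rintro x -
    obtain ⟨f, rfl⟩ := Submodule.Quotient.mk_surjective _ x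
    -- Taylor expansion at `a` writes `f` in powers of `X - C a`; powers from the `k`-th on die in
    -- the quotient.
    rw [← sum_taylor_eq f a, Polynomial.sum, ← Submodule.mkQ_apply, map_sum]
    refine Submodule.sum_mem _ fun i _ => ?_
    rw [← smul_eq_C_mul, Submodule.mkQ_apply, Submodule.Quotient.mk_smul]
    refine Submodule.smul_mem _ _ ?_
    rcases lt_or_ge i k with h | h
    · exact Submodule.subset_span ⟨⟨i, h⟩, rfl⟩
    · have : (Submodule.Quotient.mk ((X - C a) ^ i) :
          K[X] ⧸ Submodule.span K[X] {(X - C a) ^ k}) = 0 := by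
        rw [Submodule.Quotient.mk_eq_zero]
        exact Ideal.mem_span_singleton.2 (pow_dvd_pow _ h)
      rw [this]
      exact Submodule.zero_mem _
  have hcard : Fintype.card (Fin k) =
      Module.finrank K (K[X] ⧸ Submodule.span K[X] {(X - C a) ^ k}) := by
    have := finrank_quotient_span_eq_natDegree (f := (X - C a) ^ k)
    rw [natDegree_pow, natDegree_X_sub_C, mul_one] at this
    rw [Fintype.card_fin]
    exact this.symm
  -- The order is reversed so that multiplication by `X - C a` lowers the index, as in a Jordan
  -- chain.
  refine ⟨(Module.Basis.mk (linearIndependent_of_top_le_span_of_card_eq_finrank hspan hcard)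
    hspan).reindex Fin.revPerm, fun j => ?_⟩
  rw [Module.Basis.reindex_apply, Module.Basis.mk_apply]
  simp only [v, Fin.revPerm_symm, Fin.revPerm_apply, Fin.val_rev]
  congr 2
  omega

theorem span_singleton_irreducible_pow (p : ℂ[X]) (hp : Irreducible p) :
    ∃ a : ℂ, ∀ e : ℕ, Submodule.span ℂ[X] {p ^ e} = Submodule.span ℂ[X] {(X - C a) ^ e} := by
  obtain ⟨a, ha⟩ := IsAlgClosed.exists_root p (by
    rw [IsAlgClosed.degree_eq_one_of_irreducible ℂ hp]; simp)
  have h : Associated (X - C a) p :=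
    (irreducible_X_sub_C a).associated_of_dvd hp (dvd_iff_isRoot.2 ha)
  exact ⟨a, fun e => Ideal.span_singleton_eq_span_singleton.2 (h.symm.pow_pow)⟩

theorem dfinsupp_basis_apply {ι R : Type*} [DecidableEq ι] [Semiring R] {M : ι → Type*}
    [∀ i, AddCommMonoid (M i)] [∀ i, Module R (M i)] {η : ι → Type*}
    (b : ∀ i, Module.Basis (η i) R (M i)) (i : ι) (j : η i) :
    DFinsupp.basis b ⟨i, j⟩ = DFinsupp.single i (b i j) := by
  classical
  apply (DFinsupp.basis b).repr.injective
  rw [Module.Basis.repr_self]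
  simp only [DFinsupp.basis, LinearEquiv.trans_apply, DFinsupp.mapRange.linearEquiv_apply,
    DFinsupp.mapRange_single, Module.Basis.repr_self]
  rw [LinearEquiv.eq_symm_apply]
  exact sigmaFinsuppEquivDFinsupp_single _ _

variable {W : Type*} [AddCommGroup W] [Module ℂ W] [FiniteDimensional ℂ W]

/-- Structure theorem for finitely generated torsion modules over `ℂ[X]`, with `X` acting as `M`.
Blocks of size zero are still allowed here. -/
theorem exists_jordan_chains (M : Module.End ℂ W) :
    ∃ (ι : Type) (_ : Fintype ι) (k : ι → ℕ) (a : ι → ℂ)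
      (b : Module.Basis (Σ i, Fin (k i)) ℂ W),
      (∀ i (h : 0 < k i), M (b ⟨i, ⟨0, h⟩⟩) = a i • b ⟨i, ⟨0, h⟩⟩) ∧
      ∀ i (j : ℕ) (h : j + 1 < k i), M (b ⟨i, ⟨j + 1, h⟩⟩) =
        a i • b ⟨i, ⟨j + 1, h⟩⟩ + b ⟨i, ⟨j, Nat.lt_of_succ_lt h⟩⟩ := by
  classical
  -- Torsion by Cayley–Hamilton.
  have htors : Module.IsTorsion ℂ[X] (Module.AEval' M) := by
    intro x
    refine ⟨⟨M.charpoly, mem_nonZeroDivisors_of_ne_zero M.charpoly_monic.ne_zero⟩, ?_⟩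
    apply (Module.AEval'.of M).symm.injective
    rw [Submonoid.mk_smul, Module.AEval.of_symm_smul, LinearMap.aeval_self_charpoly, zero_smul,
      map_zero]
  obtain ⟨ι, _, p, hp, k, ⟨e⟩⟩ := Module.equiv_directSum_of_isTorsion htors
  choose a ha using fun i => span_singleton_irreducible_pow (p i) (hp i)
  choose b hb using fun i => exists_basis_quotient_X_sub_C_pow (a i) (k i)
  let e' : Module.AEval' M ≃ₗ[ℂ[X]] Π₀ i, ℂ[X] ⧸ Submodule.span ℂ[X] {(X - C (a i)) ^ k i} :=
    e.trans (DFinsupp.mapRange.linearEquiv fun i => Submodule.quotEquivOfEq _ _ (ha i (k i)))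
  let B : Module.Basis (Σ i, Fin (k i)) ℂ W :=
    (DFinsupp.basis b).map ((e'.restrictScalars ℂ).symm.trans (Module.AEval'.of M).symm)
  have hB : ∀ i (j : Fin (k i)), Module.AEval'.of M (B ⟨i, j⟩) =
      e'.symm (DFinsupp.single i (Submodule.Quotient.mk ((X - C (a i)) ^ (k i - 1 - (j : ℕ))))) := by
    intro i j
    rw [← hb]
    simp only [B, Module.Basis.map_apply, LinearEquiv.trans_apply, LinearEquiv.apply_symm_apply,
      dfinsupp_basis_apply]
    rfl
  have key : ∀ i (j : Fin (k i)), Module.AEval'.of M (M (B ⟨i, j⟩)) =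
      a i • Module.AEval'.of M (B ⟨i, j⟩) +
      e'.symm (DFinsupp.single i (Submodule.Quotient.mk ((X - C (a i)) ^ (k i - 1 - (j : ℕ) + 1)))) := by
    intro i j
    rw [← Module.AEval'.X_smul_of, pow_succ', ← smul_eq_mul (X - C (a i)), Submodule.Quotient.mk_smul,
      DFinsupp.single_smul, map_smul, ← hB, sub_smul, Module.AEval.C_smul, add_sub_cancel]
  refine ⟨ι, inferInstance, k, a, B, fun i h => ?_, fun i j h => ?_⟩
  · apply (Module.AEval'.of M).injective
    rw [key, map_smul, add_eq_left, map_eq_zero_iff _ e'.symm.injective, DFinsupp.single_eq_zero,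
      Submodule.Quotient.mk_eq_zero]
    -- At index `0` the raised exponent is exactly `k i`, so the class is zero.
    exact Ideal.mem_span_singleton.2 (pow_dvd_pow _ (by simp; omega))
  · apply (Module.AEval'.of M).injective
    rw [key, map_add, map_smul, hB i ⟨j, _⟩]
    congr 5
    simp
    omega

theorem nonempty_jordanForm (M : Module.End ℂ W) : Nonempty (JordanForm M) := by
  classical
  obtain ⟨ι, _, k, a, b, h0, hs⟩ := exists_jordan_chains M
  let g := (Fintype.equivFin {i // 0 < k i}).symm
  let f : (Σ i, Fin (k (g i))) → Σ i, Fin (k i) := fun x => ⟨g x.1, x.2⟩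
  have hf : Function.Bijective f := by
    constructor
    · rintro ⟨i, x⟩ ⟨j, y⟩ h
      obtain rfl : i = j := g.injective (Subtype.ext (congrArg Sigma.fst h))
      simpa [f] using h
    · rintro ⟨i, x⟩
      obtain ⟨j, hj⟩ := g.surjective ⟨i, x.pos⟩
      obtain rfl : (g j : ι) = i := congrArg Subtype.val hj
      exact ⟨⟨j, x⟩, rfl⟩
  exact ⟨{
    numBlocks := Fintype.card {i // 0 < k i}
    size := fun i => k (g i)
    size_pos := fun i => (g i).2
    eigenvalue := fun i => a (g i)
    basis := b.reindex (Equiv.ofBijective f hf).symm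
    apply_zero := fun i h => by simpa [f] using h0 (g i) h
    apply_succ := fun i j h => by simpa [f] using hs (g i) j h }⟩

end JordanForm
-- Comparison of norms in finite dimension
section Seminorm

variable {E F : Type*} [AddCommGroup E] [Module ℝ E] [FiniteDimensional ℝ E]
  [NormedAddCommGroup F] [NormedSpace ℝ F]

omit [FiniteDimensional ℝ E] in
theorem normedSpaceCore_of_definite (p : Seminorm ℝ E) (hp : ∀ x, p x = 0 → x = 0) :
    letI : Norm E := ⟨p⟩
    NormedSpace.Core ℝ E :=
  letI : Norm E := ⟨p⟩
  { norm_nonneg := apply_nonneg p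
    norm_smul := map_smul_eq_mul p
    norm_triangle := map_add_le_add p
    norm_eq_zero_iff := fun x => ⟨hp x, fun h => h ▸ map_zero p⟩ }

theorem exists_norm_le_mul_of_definite (p : Seminorm ℝ E) (hp : ∀ x, p x = 0 → x = 0)
    (L : E →ₗ[ℝ] F) : ∃ C > 0, ∀ x, ‖L x‖ ≤ C * p x := by
  let _ : Norm E := ⟨p⟩
  let _ := NormedAddCommGroup.ofCore (normedSpaceCore_of_definite p hp)
  let _ := NormedSpace.ofCore (normedSpaceCore_of_definite p hp)
  exact (LinearMap.toContinuousLinearMap L).bound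

theorem exists_le_mul_norm_of_definite (p : Seminorm ℝ E) (hp : ∀ x, p x = 0 → x = 0)
    (L : E →ₗ[ℝ] F) (hL : Function.Injective L) : ∃ C > 0, ∀ x, p x ≤ C * ‖L x‖ := by
  let _ : Norm E := ⟨p⟩
  let _ := NormedAddCommGroup.ofCore (normedSpaceCore_of_definite p hp)
  let _ := NormedSpace.ofCore (normedSpaceCore_of_definite p hp)
  obtain ⟨K, hK, h⟩ := L.exists_antilipschitzWith (LinearMap.ker_eq_bot.2 hL)
  refine ⟨K, hK, fun x => ?_⟩
  have hx : ‖x‖ ≤ K * ‖L x‖ := by simpa using h.le_mul_dist x 0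
  exact hx

end Seminorm

/-! ### Estimates of `n.choose j * r ^ (n - j)` against the growth rate -/

section Rate

/-- The growth rate `r ^ (n - k) * n ^ k` of the powers of a Jordan block of size `k + 1`. -/
noncomputable def growthRate (r : ℝ) (k n : ℕ) : ℝ :=
  r ^ ((n : ℤ) - k) * (n : ℝ) ^ k

theorem growthRate_nonneg {r : ℝ} (hr : 0 ≤ r) (k n : ℕ) : 0 ≤ growthRate r k n := by
  unfold growthRate; positivity

theorem growthRate_of_le {r : ℝ} {k n : ℕ} (h : k ≤ n) :
    growthRate r k n = r ^ (n - k) * (n : ℝ) ^ k := by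
  rw [growthRate, ← Nat.cast_sub h, zpow_natCast]

theorem growthRate_of_pos {r : ℝ} (hr : 0 < r) (k n : ℕ) :
    growthRate r k n = r ^ n / r ^ k * (n : ℝ) ^ k := by
  rw [growthRate, zpow_sub₀ hr.ne', zpow_natCast, zpow_natCast]

/-- The left side vanishes unless `j = n`, which forces `j = k = n`; there `0 ^ 0 = 1` on both
sides. -/
theorem choose_mul_zero_pow_le (k j n : ℕ) (hn : 1 ≤ n) (hjk : j ≤ k) (hkn : k ≤ n) :
    (n.choose j : ℝ) * 0 ^ (n - j) ≤ growthRate 0 k n := by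
  rcases hjk.trans hkn |>.lt_or_eq with h | h
  · rw [zero_pow (by omega), mul_zero]
    exact growthRate_nonneg le_rfl k n
  · obtain rfl : j = k := by omega
    subst h
    rw [growthRate_of_le le_rfl]
    simpa using one_le_pow₀ (by exact_mod_cast hn : (1 : ℝ) ≤ j)

theorem choose_mul_pow_le {r : ℝ} (hr : 0 < r) (j n : ℕ) :
    (n.choose j : ℝ) * r ^ (n - j) ≤ (n : ℝ) ^ j * (r ^ n / r ^ j) := by
  rcases le_or_gt j n with h | h
  · rw [pow_sub₀ _ hr.ne' h, ← div_eq_mul_inv]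
    gcongr
    exact_mod_cast Nat.choose_le_pow n j
  · rw [Nat.choose_eq_zero_of_lt h]
    simp only [Nat.cast_zero, zero_mul]
    positivity

theorem exists_choose_mul_pow_le_of_lt {r s : ℝ} (hr : 0 ≤ r) (hrs : r < s) (j k : ℕ) :
    ∃ C > 0, ∀ n : ℕ, 1 ≤ n → (n.choose j : ℝ) * r ^ (n - j) ≤ C * growthRate s k n := by
  have hs : 0 < s := hr.trans_lt hrs
  -- An intermediate `t` is positive even if `r = 0`, and `n ^ j * (t / s) ^ n` stays bounded,
  -- absorbing the polynomial factor.
  obtain ⟨t, hrt, hts⟩ := exists_between hrs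
  have ht : 0 < t := hr.trans_lt hrt
  obtain ⟨B, hB⟩ := (tendsto_pow_const_mul_const_pow_of_lt_one j (div_nonneg ht.le hs.le)
    ((div_lt_one hs).2 hts)).bddAbove_range
  have hB' : ∀ n : ℕ, (n : ℝ) ^ j * (t / s) ^ n ≤ B := fun n => hB ⟨n, rfl⟩
  have hB1 : 0 < max B 1 := by positivity
  refine ⟨max B 1 * s ^ k / t ^ j, by positivity, fun n hn => ?_⟩
  calc (n.choose j : ℝ) * r ^ (n - j) ≤ n.choose j * t ^ (n - j) := by gcongr
    _ ≤ (n : ℝ) ^ j * (t ^ n / t ^ j) := choose_mul_pow_le ht j n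
    _ = ((n : ℝ) ^ j * (t / s) ^ n) * s ^ n / t ^ j := by
      rw [div_pow]; field_simp
    _ ≤ max B 1 * s ^ n / t ^ j := by
      gcongr
      exact (hB' n).trans (le_max_left _ _)
    _ = (max B 1 * s ^ k / t ^ j) * (s ^ n / s ^ k * 1) := by field_simp
    _ ≤ _ := by
      rw [growthRate_of_pos hs]
      gcongr
      exact one_le_pow₀ (by exact_mod_cast hn)

theorem exists_choose_mul_pow_le_of_le {r : ℝ} (hr : 0 ≤ r) {j k : ℕ} (hjk : j ≤ k) :
    ∃ C > 0, ∀ n : ℕ, 1 ≤ n → (r = 0 → k ≤ n) →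
      (n.choose j : ℝ) * r ^ (n - j) ≤ C * growthRate r k n := by
  rcases hr.eq_or_lt with rfl | hr
  · exact ⟨1, one_pos, fun n hn hkn => by
      simpa using choose_mul_zero_pow_le k j n hn hjk (hkn rfl)⟩
  · refine ⟨r ^ k / r ^ j, by positivity, fun n hn _ => ?_⟩
    refine (choose_mul_pow_le hr j n).trans ?_
    calc (n : ℝ) ^ j * (r ^ n / r ^ j) ≤ (n : ℝ) ^ k * (r ^ n / r ^ j) := by
          gcongr
          exact_mod_cast hn
      _ = _ := by rw [growthRate_of_pos hr]; field_simp

theorem exists_mul_growthRate_le_choose (k : ℕ) :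
    ∃ c > 0, ∀ (r : ℝ) (n : ℕ), 0 ≤ r → k ≤ n →
      c * growthRate r k n ≤ (n.choose k : ℝ) * r ^ (n - k) := by
  -- Combines `(n + 1 - k) ^ k ≤ k! * n.choose k` with `n ≤ (k + 1) * (n + 1 - k)`.
  refine ⟨1 / ((k + 1) ^ k * k.factorial), by positivity, fun r n hr hkn => ?_⟩
  rw [growthRate_of_le hkn]
  have h1 : ((n + 1 - k : ℕ) ^ k : ℝ) ≤ k.factorial * n.choose k := by
    exact_mod_cast Nat.pow_sub_le_descFactorial n k |>.trans
      (Nat.descFactorial_eq_factorial_mul_choose n k).le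
  have h2 : (n : ℝ) ≤ (k + 1) * (n + 1 - k : ℕ) := by
    obtain ⟨m, rfl⟩ := Nat.exists_eq_add_of_le hkn
    rw [show k + m + 1 - k = m + 1 by omega]
    push_cast
    nlinarith [(k.cast_nonneg : (0 : ℝ) ≤ k), (m.cast_nonneg : (0 : ℝ) ≤ m),
      mul_nonneg (k.cast_nonneg : (0 : ℝ) ≤ k) (m.cast_nonneg : (0 : ℝ) ≤ m)]
  have h3 : (n : ℝ) ^ k ≤ (k + 1) ^ k * (k.factorial * n.choose k) :=
    (pow_le_pow_left₀ n.cast_nonneg h2 k).trans (by rw [mul_pow]; gcongr)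
  rw [one_div_mul_eq_div, div_le_iff₀ (by positivity)]
  calc r ^ (n - k) * (n : ℝ) ^ k
      ≤ r ^ (n - k) * ((k + 1) ^ k * (k.factorial * n.choose k)) := by gcongr
    _ = _ := by ring

/-- For `n < k` the binomial coefficient `n.choose k` vanishes while the rate, with its negative
power of `r`, does not; here `r ^ n`, a diagonal entry of the block, is the lower bound instead. -/
theorem exists_mul_growthRate_le_pow {r : ℝ} (hr : 0 < r) (k : ℕ) :
    ∃ c > 0, ∀ n : ℕ, n ≤ k → c * growthRate r k n ≤ r ^ n := by
  refine ⟨r ^ k / (k + 1) ^ k, by positivity, fun n hn => ?_⟩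
  rw [growthRate_of_pos hr]
  have : (n : ℝ) ^ k ≤ (k + 1) ^ k := by
    gcongr
    exact_mod_cast hn.trans k.le_succ
  calc _ = r ^ n * ((n : ℝ) ^ k / (k + 1) ^ k) := by field_simp
    _ ≤ r ^ n * 1 := by
      gcongr
      exact (div_le_one (by positivity)).2 this
    _ = _ := mul_one _

end Rate

/-! ### Powers of Jordan blocks and the two-sided bound -/

section Growth

variable {W : Type*} [AddCommGroup W] [Module ℂ W]

theorem choose_succ_mul_pow (z : ℂ) (n k : ℕ) :
    ((n + 1).choose (k + 1) : ℂ) * z ^ (n + 1 - (k + 1)) =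
      n.choose k * z ^ (n - k) + z * (n.choose (k + 1) * z ^ (n - (k + 1))) := by
  rw [Nat.choose_succ_succ, Nat.cast_add, add_mul, Nat.add_sub_add_right]
  congr 1
  rcases lt_or_ge k n with h | h
  · obtain ⟨m, rfl⟩ := Nat.exists_eq_add_of_lt h
    rw [show k + m + 1 - k = m + 1 by omega, show k + m + 1 - (k + 1) = m by omega]
    ring
  · rw [Nat.choose_eq_zero_of_lt (by omega)]
    simp

/-- Binomial expansion of `(z + N) ^ n`, with `N` the shift down the chain, proved by Pascal's rule.
-/
theorem pow_apply_jordan_chain (M : Module.End ℂ W) {z : ℂ} {u : ℕ → W} (h0 : M (u 0) = z • u 0)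
    {j : ℕ} (hs : ∀ l < j, M (u (l + 1)) = z • u (l + 1) + u l) (n : ℕ) :
    (M ^ n) (u j) =
      ∑ k ∈ Finset.range (j + 1), ((n.choose k : ℂ) * z ^ (n - k)) • u (j - k) := by
  induction n generalizing j with
  | zero => simp [Finset.sum_range_succ']
  | succ n ih =>
    rw [pow_succ, Module.End.mul_apply]
    cases j with
    | zero => rw [h0, map_smul, ih (by simp)]; simp [smul_smul, pow_succ']
    | succ j =>
      rw [hs j j.lt_succ_self, map_add, map_smul, ih hs, ih fun l hl => hs l (hl.trans j.lt_succ_self),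
        Finset.sum_range_succ', Finset.sum_range_succ' _ (j + 1), smul_add, add_right_comm,
        Finset.smul_sum, ← Finset.sum_add_distrib]
      congr 1
      · refine Finset.sum_congr rfl fun k _ => ?_
        rw [Nat.add_sub_add_right, choose_succ_mul_pow, smul_smul, ← add_smul, add_comm]
      · simp [smul_smul, pow_succ']

variable {M : Module.End ℂ W}

namespace JordanForm

variable (J : JordanForm M)

/-- The `i`-th chain of a Jordan basis, extended by zero. -/
noncomputable def chain (i : Fin J.numBlocks) (j : ℕ) : W :=
  if h : j < J.size i then J.basis ⟨i, ⟨j, h⟩⟩ else 0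

theorem chain_of_lt {i : Fin J.numBlocks} {j : ℕ} (h : j < J.size i) :
    J.chain i j = J.basis ⟨i, ⟨j, h⟩⟩ :=
  dif_pos h

theorem apply_chain_zero (i : Fin J.numBlocks) :
    M (J.chain i 0) = J.eigenvalue i • J.chain i 0 := by
  rw [chain_of_lt J (J.size_pos i), J.apply_zero]

theorem apply_chain_succ {i : Fin J.numBlocks} {j : ℕ} (h : j + 1 < J.size i) :
    M (J.chain i (j + 1)) = J.eigenvalue i • J.chain i (j + 1) + J.chain i j := by
  rw [chain_of_lt J h, chain_of_lt J (Nat.lt_of_succ_lt h), J.apply_succ]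

theorem pow_apply_chain {i : Fin J.numBlocks} {j : ℕ} (h : j < J.size i) (n : ℕ) :
    (M ^ n) (J.chain i j) = ∑ k ∈ Finset.range (j + 1),
      ((n.choose k : ℂ) * J.eigenvalue i ^ (n - k)) • J.chain i (j - k) :=
  pow_apply_jordan_chain M (J.apply_chain_zero i)
    (fun _ hl => J.apply_chain_succ (by omega)) n

theorem repr_chain {i : Fin J.numBlocks} {j l : ℕ} (hj : j < J.size i) (hl : l < J.size i) :
    J.basis.repr (J.chain i j) ⟨i, ⟨l, hl⟩⟩ = if j = l then 1 else 0 := by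
  classical
  rw [chain_of_lt J hj, Module.Basis.repr_self, Finsupp.single_apply]
  simp

theorem norm_repr_chain_le (i : Fin J.numBlocks) (j : ℕ) (y : Σ i, Fin (J.size i)) :
    ‖J.basis.repr (J.chain i j) y‖ ≤ 1 := by
  classical
  unfold chain
  split_ifs
  · rw [Module.Basis.repr_self, Finsupp.single_apply]
    split_ifs <;> simp
  · simp

theorem size_le_finrank [FiniteDimensional ℂ W] (i : Fin J.numBlocks) :
    J.size i ≤ Module.finrank ℂ W := by
  rw [Module.finrank_eq_card_basis J.basis, Fintype.card_sigma]
  simpa using Finset.single_le_sum (f := J.size) (fun _ _ => Nat.zero_le _) (Finset.mem_univ i)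

theorem eigenvalue_mem_spectrum [FiniteDimensional ℂ W] (i : Fin J.numBlocks) :
    J.eigenvalue i ∈ spectrum ℂ M := by
  rw [← Module.End.hasEigenvalue_iff_mem_spectrum]
  refine Module.End.hasEigenvalue_of_hasEigenvector
    (x := J.basis ⟨i, ⟨0, J.size_pos i⟩⟩) ⟨?_, J.basis.ne_zero _⟩
  rw [Module.End.mem_eigenspace_iff, J.apply_zero]

theorem exists_eigenvalue_eq [FiniteDimensional ℂ W] {z : ℂ} (hz : z ∈ spectrum ℂ M) :
    ∃ i, J.eigenvalue i = z := by
  by_contra! h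
  refine hz ?_
  rw [spectrum.mem_resolventSet_iff, ← IsUnit.sub_iff, LinearMap.isUnit_iff_range_eq_top,
    eq_top_iff, ← J.basis.span_eq, Submodule.span_le]
  rintro _ ⟨⟨i, j, hj⟩, rfl⟩
  have hi : J.eigenvalue i - z ≠ 0 := sub_ne_zero.2 (h i)
  -- If no block has eigenvalue `z`, then `M - z` is onto: each chain is reached from its bottom
  -- upwards, dividing by `J.eigenvalue i - z`.
  induction j with
  | zero =>
    refine ⟨(J.eigenvalue i - z)⁻¹ • J.basis ⟨i, ⟨0, hj⟩⟩, ?_⟩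
    rw [map_smul, LinearMap.sub_apply, J.apply_zero, Module.algebraMap_end_apply, ← sub_smul,
      smul_smul, inv_mul_cancel₀ hi, one_smul]
  | succ j ih =>
    obtain ⟨x, hx⟩ := ih (Nat.lt_of_succ_lt hj)
    refine ⟨(J.eigenvalue i - z)⁻¹ • (J.basis ⟨i, ⟨j + 1, hj⟩⟩ - x), ?_⟩
    rw [map_smul, map_sub, hx, LinearMap.sub_apply, J.apply_succ, Module.algebraMap_end_apply,
      add_sub_right_comm, add_sub_cancel_right, ← sub_smul, smul_smul, inv_mul_cancel₀ hi, one_smul]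

end JordanForm

/-- The matrix entries of an endomorphism with respect to a basis. -/
noncomputable def coordinates {ι : Type*} (b : Module.Basis ι ℂ W) :
    Module.End ℂ W →ₗ[ℂ] (ι → ι → ℂ) :=
  LinearMap.pi fun i => LinearMap.pi fun j => b.coord j ∘ₗ LinearMap.applyₗ (b i)

theorem coordinates_apply {ι : Type*} (b : Module.Basis ι ℂ W) (A : Module.End ℂ W) (i j : ι) :
    coordinates b A i j = b.repr (A (b i)) j :=
  rfl

theorem coordinates_injective {ι : Type*} (b : Module.Basis ι ℂ W) :
    Function.Injective (coordinates b) := by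
  intro A B h
  refine b.ext fun i => b.repr.injective (Finsupp.ext fun j => ?_)
  exact congrFun (congrFun h i) j

theorem norm_repr_le_norm_coordinates {ι : Type*} [Fintype ι] (b : Module.Basis ι ℂ W)
    (A : Module.End ℂ W) (i j : ι) : ‖b.repr (A (b i)) j‖ ≤ ‖coordinates b A‖ :=
  (norm_le_pi_norm (coordinates b A i) j).trans (norm_le_pi_norm (coordinates b A) i)

theorem exists_norm_pi_le_of_forall {ι : Type*} [Fintype ι] {S : Set ℕ} {g : ℕ → ℝ}
    (hg : ∀ n, 0 ≤ g n) {F : Type*} [SeminormedAddCommGroup F] (f : ℕ → ι → F)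
    (h : ∀ i, ∃ C > 0, ∀ n ∈ S, ‖f n i‖ ≤ C * g n) :
    ∃ C > 0, ∀ n ∈ S, ‖f n‖ ≤ C * g n := by
  choose C hC hf using h
  have hsum : 0 ≤ ∑ i, C i := Finset.sum_nonneg fun i _ => (hC i).le
  -- The `+ 1` keeps the constant positive when `ι` is empty.
  refine ⟨∑ i, C i + 1, by positivity, fun n hn => ?_⟩
  refine (pi_norm_le_iff_of_nonneg (mul_nonneg (by positivity) (hg n))).2 fun i => ?_
  refine (hf i n hn).trans (mul_le_mul_of_nonneg_right ?_ (hg n))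
  have := Finset.single_le_sum (f := C) (fun i _ => (hC i).le) (Finset.mem_univ i)
  linarith

namespace JordanForm

variable (J : JordanForm M)

theorem exists_norm_coordinates_pow_le {r : ℝ} (hr : 0 ≤ r) (k : ℕ)
    (hJ : ∀ i, ‖J.eigenvalue i‖ < r ∨ (‖J.eigenvalue i‖ = r ∧ J.size i ≤ k + 1)) :
    ∃ C > 0, ∀ n ∈ {n : ℕ | 1 ≤ n ∧ (r = 0 → k ≤ n)},
      ‖coordinates J.basis (M ^ n)‖ ≤ C * growthRate r k n := by
  refine exists_norm_pi_le_of_forall (growthRate_nonneg hr k) _ fun ⟨i, j, hj⟩ =>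
    exists_norm_pi_le_of_forall (growthRate_nonneg hr k) _ fun y => ?_
  have h : ∀ l : Fin (j + 1), ∃ C > 0, ∀ n ∈ {n : ℕ | 1 ≤ n ∧ (r = 0 → k ≤ n)},
      (n.choose l : ℝ) * ‖J.eigenvalue i‖ ^ (n - l) ≤ C * growthRate r k n := by
    intro l
    rcases hJ i with h | ⟨h, hi⟩
    · obtain ⟨C, hC, h⟩ := exists_choose_mul_pow_le_of_lt (norm_nonneg _) h l k
      exact ⟨C, hC, fun n hn => h n hn.1⟩
    · obtain ⟨C, hC, h'⟩ := exists_choose_mul_pow_le_of_le hr (show (l : ℕ) ≤ k by omega)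
      exact ⟨C, hC, fun n hn => h ▸ h' n hn.1 hn.2⟩
  choose C hC hle using h
  refine ⟨∑ l, C l, Finset.sum_pos (fun l _ => hC l) Finset.univ_nonempty, fun n hn => ?_⟩
  rw [coordinates_apply, ← chain_of_lt, pow_apply_chain J hj, map_sum, Finsupp.finsetSum_apply,
    Finset.sum_range, Finset.sum_mul]
  refine (norm_sum_le _ _).trans (Finset.sum_le_sum fun l _ => ?_)
  rw [map_smul, Finsupp.smul_apply, norm_smul, norm_mul, norm_pow, Complex.norm_natCast]
  exact (mul_le_of_le_one_right (by positivity) (J.norm_repr_chain_le _ _ _)).trans (hle l n hn)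

/-- The right side dominates a single entry: the coefficient of the bottom vector of the chain in `M
^ n` applied to its `j`-th vector. -/
theorem choose_mul_pow_le_norm_coordinates_pow (i : Fin J.numBlocks) {j : ℕ} (hj : j < J.size i)
    (n : ℕ) :
    (n.choose j : ℝ) * ‖J.eigenvalue i‖ ^ (n - j) ≤ ‖coordinates J.basis (M ^ n)‖ := by
  refine le_trans (le_of_eq ?_) (norm_repr_le_norm_coordinates J.basis (M ^ n) ⟨i, ⟨j, hj⟩⟩
    ⟨i, ⟨0, J.size_pos i⟩⟩)
  rw [← chain_of_lt, pow_apply_chain J hj, map_sum, Finsupp.finsetSum_apply,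
    Finset.sum_eq_single_of_mem j (by simp)]
  · rw [map_smul, Finsupp.smul_apply, repr_chain J (by omega)]
    simp
  · intro l hl hlj
    rw [Finset.mem_range] at hl
    rw [map_smul, Finsupp.smul_apply, repr_chain J (by omega), if_neg (by omega), smul_zero]

/-- The corner entry (`j = k`) serves for `n ≥ k`, the diagonal entry (`j = 0`) for the finitely
many smaller `n`. -/
theorem exists_le_norm_coordinates_pow {k : ℕ} (i : Fin J.numBlocks) (hi : J.size i = k + 1) :
    ∃ c > 0, ∀ n : ℕ, (‖J.eigenvalue i‖ = 0 → k ≤ n) →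
      c * growthRate ‖J.eigenvalue i‖ k n ≤ ‖coordinates J.basis (M ^ n)‖ := by
  obtain ⟨c, hc, hle⟩ := exists_mul_growthRate_le_choose k
  have h1 : ∀ n, k ≤ n →
      c * growthRate ‖J.eigenvalue i‖ k n ≤ ‖coordinates J.basis (M ^ n)‖ := fun n hn =>
    (hle _ n (norm_nonneg _) hn).trans
      (J.choose_mul_pow_le_norm_coordinates_pow i (by omega) n)
  rcases (norm_nonneg (J.eigenvalue i)).eq_or_lt with h | h
  · exact ⟨c, hc, fun n hn => h1 n (hn h.symm)⟩
  · obtain ⟨c', hc', hle'⟩ := exists_mul_growthRate_le_pow h k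
    refine ⟨min c c', lt_min hc hc', fun n _ => ?_⟩
    have hg := growthRate_nonneg h.le k n
    rcases le_total k n with hn | hn
    · exact (mul_le_mul_of_nonneg_right (min_le_left _ _) hg).trans (h1 n hn)
    · refine (mul_le_mul_of_nonneg_right (min_le_right _ _) hg).trans ((hle' n hn).trans ?_)
      simpa using J.choose_mul_pow_le_norm_coordinates_pow i (J.size_pos i) n

end JordanForm

variable [FiniteDimensional ℂ W]

theorem exists_norm_eq_specRad [Nontrivial W] (M : Module.End ℂ W) :
    ∃ z ∈ spectrum ℂ M, ‖z‖ = specRad M ∧ ∀ w ∈ spectrum ℂ M, ‖w‖ ≤ specRad M := by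
  obtain ⟨z, hz, hmax⟩ := Set.exists_max_image (spectrum ℂ M) (fun w => ‖w‖₊)
    (Module.End.finite_spectrum M) (spectrum.nonempty_of_isAlgClosed_of_finiteDimensional ℂ M)
  have h : spectralRadius ℂ M = ‖z‖₊ :=
    le_antisymm (iSup₂_le fun w hw => by exact_mod_cast hmax w hw)
      (le_iSup₂_of_le (f := fun w (_ : w ∈ spectrum ℂ M) => (‖w‖₊ : ENNReal)) z hz le_rfl)
  have h' : specRad M = ‖z‖ := by simp [specRad, h]
  exact ⟨z, hz, h'.symm, fun w hw => h' ▸ hmax w hw⟩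

/-- Some Jordan form contains a block of the maximal size among those of spectral radius. -/
theorem exists_maximal_jordan_block [Nontrivial W] (M : Module.End ℂ W) :
    ∃ (J : JordanForm M) (i : Fin J.numBlocks), ‖J.eigenvalue i‖ = specRad M ∧
      J.size i = maxJordanBlock M (specRad M) ∧
      ∀ l, ‖J.eigenvalue l‖ < specRad M ∨
        (‖J.eigenvalue l‖ = specRad M ∧ J.size l ≤ maxJordanBlock M (specRad M)) := by
  obtain ⟨z, hz, hzr, hmax⟩ := exists_norm_eq_specRad M
  -- A bounded nonempty set of naturals attains its `sSup`. Choosing a form `J` that attains it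
  -- avoids the uniqueness of Jordan forms.
  have hbdd : BddAbove {k | ∃ (J : JordanForm M) (i : Fin J.numBlocks),
      ‖J.eigenvalue i‖ = specRad M ∧ J.size i = k} := by
    refine ⟨Module.finrank ℂ W, ?_⟩
    rintro _ ⟨J, i, -, rfl⟩
    exact J.size_le_finrank i
  obtain ⟨J₀⟩ := nonempty_jordanForm M
  obtain ⟨i₀, rfl⟩ := J₀.exists_eigenvalue_eq hz
  have hne : {k | ∃ (J : JordanForm M) (i : Fin J.numBlocks),
      ‖J.eigenvalue i‖ = specRad M ∧ J.size i = k}.Nonempty := ⟨_, J₀, i₀, hzr, rfl⟩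
  obtain ⟨J, i, h, hi⟩ := Nat.sSup_mem hne hbdd
  refine ⟨J, i, h, hi, fun l => ?_⟩
  rcases (hmax _ (J.eigenvalue_mem_spectrum l)).lt_or_eq with hl | hl
  · exact Or.inl hl
  · exact Or.inr ⟨hl, le_csSup hbdd ⟨J, l, hl, rfl⟩⟩

/-- The real space `E` with an injection `φ` lets one argument serve both cases: `φ` is the identity
for complex `V` and complexification for real `V`. -/
theorem exists_growth_bounds [Nontrivial W] {E : Type*} [AddCommGroup E] [Module ℝ E]
    [FiniteDimensional ℝ E] (p : Seminorm ℝ E) (hp : ∀ x, p x = 0 → x = 0)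
    (φ : E →ₗ[ℝ] Module.End ℂ W) (hφ : Function.Injective φ) (M : Module.End ℂ W) (a : ℕ → E)
    (ha : ∀ n, 1 ≤ n → φ (a n) = M ^ n) {r : ℝ} (hr : r = specRad M) {d : ℕ}
    (hd : d = maxJordanBlock M r) :
    ∃ C₁ > (0 : ℝ), ∃ C₂ > (0 : ℝ), ∀ n : ℕ, 1 ≤ n → (r = 0 → d ≤ n + 1) →
      C₁ * r ^ ((n : ℤ) - d + 1) * (n : ℝ) ^ ((d : ℤ) - 1) ≤ p (a n) ∧
      p (a n) ≤ C₂ * r ^ ((n : ℤ) - d + 1) * (n : ℝ) ^ ((d : ℤ) - 1) := by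
  subst hr
  obtain ⟨J, i, hir, hid, hJ⟩ := exists_maximal_jordan_block M
  rw [← hd] at hid hJ
  -- Blocks are nonempty, so `d = k + 1`, and the exponents `n - d + 1` and `d - 1` become `n - k`
  -- and `k`.
  obtain ⟨k, rfl⟩ := Nat.exists_eq_add_of_le' (hid ▸ J.size_pos i : 1 ≤ d)
  let L : E →ₗ[ℝ] (Σ i, Fin (J.size i)) → (Σ i, Fin (J.size i)) → ℂ :=
    (coordinates J.basis).restrictScalars ℝ ∘ₗ φ
  have hL : Function.Injective L := (coordinates_injective J.basis).comp hφ
  obtain ⟨A, hA, hLA⟩ := exists_norm_le_mul_of_definite p hp L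
  obtain ⟨B, hB, hLB⟩ := exists_le_mul_norm_of_definite p hp L hL
  obtain ⟨C, hC, hle⟩ := J.exists_norm_coordinates_pow_le (hir ▸ norm_nonneg _) k hJ
  obtain ⟨c, hc, hge⟩ := J.exists_le_norm_coordinates_pow i hid
  rw [hir] at hge
  have hLa : ∀ n, 1 ≤ n → L (a n) = coordinates J.basis (M ^ n) := fun n hn => by
    rw [← ha n hn]; rfl
  refine ⟨c / A, by positivity, B * C, by positivity, fun n hn hdn => ?_⟩
  have hrate : ∀ D : ℝ, D * specRad M ^ ((n : ℤ) - (k + 1 : ℕ) + 1) *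
      (n : ℝ) ^ (((k + 1 : ℕ) : ℤ) - 1) = D * growthRate (specRad M) k n := fun D => by
    rw [growthRate, mul_assoc, ← zpow_natCast]
    congr 3 <;> push_cast <;> ring
  have hkn : specRad M = 0 → k ≤ n := fun h => by have := hdn h; omega
  rw [hrate, hrate]
  constructor
  · rw [div_mul_eq_mul_div, div_le_iff₀' hA]
    exact (hge n hkn).trans (hLa n hn ▸ hLA (a n))
  · refine (hLB (a n)).trans ?_
    rw [hLa n hn, mul_assoc]
    gcongr
    exact hle n ⟨hn, hkn⟩

omit [FiniteDimensional ℂ W] in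
theorem isWeaklyPowerBounded_of_seminorm {E : Type*} [AddCommGroup E] [Module ℝ E]
    [FiniteDimensional ℝ E] (p : Seminorm ℝ E) (hp : ∀ x, p x = 0 → x = 0)
    (φ : E →ₗ[ℝ] Module.End ℂ W) (T : Module.End ℂ W) (a : ℕ → E)
    (ha : ∀ n, φ (a n) = T ^ n) (hb : ∃ C : ℝ, ∀ n, p (a n) ≤ C) :
    IsWeaklyPowerBounded T := by
  intro l
  obtain ⟨A, hA, h⟩ := exists_norm_le_mul_of_definite p hp (l.restrictScalars ℝ ∘ₗ φ)
  obtain ⟨C, hC⟩ := hb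
  refine ⟨A * C, fun n => ?_⟩
  rw [← ha]
  exact (h (a n)).trans (by gcongr; exact hC n)

end Growth

/-! ### The operator norm as a definite seminorm, and the theorem -/

section Hilbert

variable {𝕜 V : Type*} [RCLike 𝕜] [NormedAddCommGroup V] [InnerProductSpace 𝕜 V]
  [FiniteDimensional 𝕜 V]

/-- The operator norm as a seminorm. -/
noncomputable def opNormSeminorm : Seminorm 𝕜 (Module.End 𝕜 V) :=
  (normSeminorm 𝕜 (V →L[𝕜] V)).comp
    (LinearMap.toContinuousLinearMap : (V →ₗ[𝕜] V) ≃ₗ[𝕜] V →L[𝕜] V).toLinearMap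

theorem opNormSeminorm_apply (A : Module.End 𝕜 V) : opNormSeminorm A = opNorm A :=
  rfl

theorem eq_zero_of_opNormSeminorm (A : Module.End 𝕜 V) (h : opNormSeminorm A = 0) : A = 0 := by
  rw [opNormSeminorm_apply, opNorm, norm_eq_zero] at h
  exact (map_eq_zero_iff _ LinearMap.toContinuousLinearMap.injective).1 h

end Hilbert

end BoundedSemigroup

theorem theorem1 :
    -- complex Hilbert spaces
    (∀ (V : Type*) [NormedAddCommGroup V] [InnerProductSpace ℂ V] [FiniteDimensional ℂ V]
      [Nontrivial V] (N : Seminorm ℂ (Module.End ℂ V)) (_ : ∀ A, N A = 0 → A = 0)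
      (T : Module.End ℂ V) (_ : ∃ C : ℝ, ∀ n : ℕ, N (T ^ n) ≤ C)
      (Tinf : Module.End ℂ V) (_ : Tinf = BoundedSemigroup.asymptoticPart T)
      (μ : ℝ) (_ : μ = BoundedSemigroup.specRad (T - Tinf))
      (d : ℕ) (_ : d = BoundedSemigroup.maxJordanBlock (T - Tinf) μ),
      ∃ C₁ > (0 : ℝ), ∃ C₂ > (0 : ℝ), ∀ n : ℕ, 1 ≤ n → (μ = 0 → d ≤ n + 1) →
        C₁ * μ ^ ((n : ℤ) - d + 1) * (n : ℝ) ^ ((d : ℤ) - 1)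
          ≤ BoundedSemigroup.opNorm (T ^ n - Tinf ^ n) ∧
        BoundedSemigroup.opNorm (T ^ n - Tinf ^ n)
          ≤ C₂ * μ ^ ((n : ℤ) - d + 1) * (n : ℝ) ^ ((d : ℤ) - 1)) ∧
    -- real Hilbert spaces; eigenvalues and Jordan blocks are those of the complexification
    (∀ (V : Type*) [NormedAddCommGroup V] [InnerProductSpace ℝ V] [FiniteDimensional ℝ V]
      [Nontrivial V] (N : Seminorm ℝ (Module.End ℝ V)) (_ : ∀ A, N A = 0 → A = 0)
      (T : Module.End ℝ V) (_ : ∃ C : ℝ, ∀ n : ℕ, N (T ^ n) ≤ C)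
      (Tinf : Module.End ℝ V) (_ : Tinf = BoundedSemigroup.asymptoticPartReal T)
      (μ : ℝ) (_ : μ = BoundedSemigroup.specRad (BoundedSemigroup.complexify (T - Tinf)))
      (d : ℕ) (_ : d = BoundedSemigroup.maxJordanBlock
        (BoundedSemigroup.complexify (T - Tinf)) μ),
      ∃ C₁ > (0 : ℝ), ∃ C₂ > (0 : ℝ), ∀ n : ℕ, 1 ≤ n → (μ = 0 → d ≤ n + 1) →
        C₁ * μ ^ ((n : ℤ) - d + 1) * (n : ℝ) ^ ((d : ℤ) - 1)
          ≤ BoundedSemigroup.opNorm (T ^ n - Tinf ^ n) ∧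
        BoundedSemigroup.opNorm (T ^ n - Tinf ^ n)
          ≤ C₂ * μ ^ ((n : ℤ) - d + 1) * (n : ℝ) ^ ((d : ℤ) - 1)) := by
  constructor
  · intro V _ _ _ _ N hN T hT Tinf hTinf μ hμ d hd
    have : FiniteDimensional ℝ (Module.End ℂ V) := FiniteDimensional.complexToReal _
    have hb : BoundedSemigroup.IsWeaklyPowerBounded T :=
      BoundedSemigroup.isWeaklyPowerBounded_of_seminorm (N.restrictScalars ℝ) hN LinearMap.id T
        (fun n => T ^ n) (fun _ => rfl) hT
    exact BoundedSemigroup.exists_growth_bounds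
      (BoundedSemigroup.opNormSeminorm.restrictScalars ℝ)
      BoundedSemigroup.eq_zero_of_opNormSeminorm LinearMap.id Function.injective_id (T - Tinf)
      (fun n => T ^ n - Tinf ^ n) (fun n hn => by subst hTinf; exact hb.pow_sub_pow hn) hμ hd
  · intro V _ _ _ _ N hN T hT Tinf hTinf μ hμ d hd
    have := BoundedSemigroup.nontrivial_complexification (V := V)
    have hb : BoundedSemigroup.IsWeaklyPowerBounded (BoundedSemigroup.complexify T) :=
      BoundedSemigroup.isWeaklyPowerBounded_of_seminorm N hN (LinearMap.baseChangeHom ℝ ℂ V V) _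
        (fun n => T ^ n) (BoundedSemigroup.complexify_pow T) hT
    refine BoundedSemigroup.exists_growth_bounds BoundedSemigroup.opNormSeminorm
      BoundedSemigroup.eq_zero_of_opNormSeminorm (LinearMap.baseChangeHom ℝ ℂ V V)
      (LinearMap.baseChangeHom_injective ℝ V ℂ) (BoundedSemigroup.complexify (T - Tinf))
      (fun n => T ^ n - Tinf ^ n) (fun n hn => ?_) hμ hd
    have h := hb.pow_sub_pow hn
    -- The power identity holds for the complexification; it is now read as an identity between
    -- complexified real maps.
    rw [← BoundedSemigroup.complexify_asymptoticPartReal, ← hTinf] at h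
    change BoundedSemigroup.complexify (T ^ n - Tinf ^ n) = _
    rwa [BoundedSemigroup.complexify_sub, BoundedSemigroup.complexify_sub,
      BoundedSemigroup.complexify_pow, BoundedSemigroup.complexify_pow]
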